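/- Let $S$ and $T$ be finite point sets in the plane $\mathbb{R}^2$, each in general position (no three points collinear), with $|S| = |T| = n$. Then $S$ and $T$ can be compatibly triangulated by adding at most $\frac{n}{6} + 3$ Steiner points to each of them. That is, there are finite sets $A, B \subset \mathbb{R}^2$ with $A \cap S = \emptyset = B \cap T$, $|A| \le \frac n6 + 3$ and $|B| \le \frac n6 + 3$, such that $S \cup A$ and $T \cup B$ are in general position and have compatible triangulations $\mathcal{T}$ and $\mathcal{T}'$, respectively, where the bijection that witnesses the compatibility maps $S$ onto $T$ and $A$ onto $B$. Here a triangulation of a finite point set $P$ in general position is an inclusion-maximal set of line segments between points of $P$ such that any two distinct segments of it intersect in a single point, which is an endpoint of both, or not at all. A triangle of a triangulation of $P$ is a triangle whose three sides belong to it and which contains no points of $P$ other than its vertices. Triangulations $\mathcal{T}$ of $P$ and $\mathcal{T}'$ of $Q$ are compatible if there is a bijection $f : P \to Q$ such that, for all $a, b, c \in P$, $\triangle(a,b,c)$ is a clockwise-oriented triangle of $\mathcal{T}$ if and only if $\triangle(f(a),f(b),f(c))$ is a clockwise-oriented triangle of $\mathcal{T}'$. -/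

import Mathlib

/-- The Euclidean plane. -/
abbrev Plane : Type := EuclideanSpace ℝ (Fin 2)

/-- No three distinct points of `S` lie on a common line. -/
def InGeneralPosition (S : Set Plane) : Prop :=
  ∀ a ∈ S, ∀ b ∈ S, ∀ c ∈ S, a ≠ b → b ≠ c → a ≠ c → ¬ Collinear ℝ ({a, b, c} : Set Plane)

/-- The closed straight line segment with the unordered pair of endpoints `e`. -/
def edgeSegment (e : Sym2 Plane) : Set Plane :=
  convexHull ℝ {x | x ∈ e}

/-- `E` is a set of (nondegenerate) line segments between points of `S`, any two of which
intersect in exactly one point, a common endpoint, or not at all. -/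
structure IsNoncrossing (S : Set Plane) (E : Set (Sym2 Plane)) : Prop where
  not_isDiag : ∀ e ∈ E, ¬ e.IsDiag
  endpoint_mem : ∀ e ∈ E, ∀ x ∈ e, x ∈ S
  inter : ∀ e ∈ E, ∀ e' ∈ E, e ≠ e' →
    edgeSegment e ∩ edgeSegment e' = ∅ ∨
      ∃ x, x ∈ e ∧ x ∈ e' ∧ edgeSegment e ∩ edgeSegment e' = {x}

/-- A triangulation of `S`: an inclusion-maximal noncrossing set of segments between points
of `S`. -/
def IsTriangulation (S : Set Plane) (E : Set (Sym2 Plane)) : Prop :=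
  Maximal (IsNoncrossing S) E

/-- Twice the signed area of the triangle `a b c`: positive if `a, b, c` are in
counterclockwise order, negative if they are in clockwise order, zero if they are collinear. -/
def signedArea (a b c : Plane) : ℝ :=
  (b 0 - a 0) * (c 1 - a 1) - (b 1 - a 1) * (c 0 - a 0)

/-- `a b c` is a clockwise-oriented triangle of the set of segments `E` on the point set `S`:
its vertices are points of `S`, its three sides belong to `E`, it is traversed clockwise, and it
is empty, i.e. contains no point of `S` other than its vertices. -/
structure IsClockwiseTriangle (S : Set Plane) (E : Set (Sym2 Plane)) (a b c : Plane) : Prop where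
  left_mem : a ∈ S
  middle_mem : b ∈ S
  right_mem : c ∈ S
  side_ab : s(a, b) ∈ E
  side_bc : s(b, c) ∈ E
  side_ca : s(c, a) ∈ E
  clockwise : signedArea a b c < 0
  empty : ∀ p ∈ S, p ∈ convexHull ℝ ({a, b, c} : Set Plane) → p = a ∨ p = b ∨ p = c

/-- The triangulations `E` of `S` and `F` of `T` are compatible by means of `f`: it is a bijection
from `S` to `T` such that `a b c` is a clockwise-oriented triangle of `E` if and only if
`f a`, `f b`, `f c` is a clockwise-oriented triangle of `F`. -/
structure CompatibleVia (S : Set Plane) (E : Set (Sym2 Plane)) (T : Set Plane)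
    (F : Set (Sym2 Plane)) (f : Plane → Plane) : Prop where
  bijOn : Set.BijOn f S T
  triangle_iff : ∀ a ∈ S, ∀ b ∈ S, ∀ c ∈ S,
    IsClockwiseTriangle S E a b c ↔ IsClockwiseTriangle T F (f a) (f b) (f c)

/-! ### Signed areas -/

/-! Two Steiner points suffice, whatever `n` is, because they force a triangulation whose
combinatorics depends on `n` alone. Choose a direction not parallel to any line through two points
of `S`, and a line in that direction with all of `S` strictly on one side. Place `u` and `v` on this
line, very far away in opposite directions. Both then see the points in the order `p 0, p 1, …` of
increasing distance from the line, one counterclockwise and the other clockwise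
(`exists_isSuspension`).

Join `u` and `v` to each other and to every `p i`, and draw the path `p 0, p 1, …`. The radial
orders make these segments noncrossing. Any missing segment is a chord `p i`, `p j` with some `p k`
between them in the order, and it is crossed by the segment from `p k` to the apex on the other side
of the chord (`exists_crossing`), so the set is maximal.

The clockwise triangles are read off from the indices: consecutive path points with one apex, and
`u`, `v`, `p 0`. Hence matching the vertices of the suspensions built for `S` and `T` index by index
is a compatible bijection (`exists_compatibleVia`). Finally `2 ≤ n / 6 + 3`. -/

lemma signedArea_rotate (a b c : Plane) : signedArea b c a = signedArea a b c := by
  unfold signedArea; ring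

lemma signedArea_swap (a b c : Plane) : signedArea a c b = -signedArea a b c := by
  unfold signedArea; ring

lemma signedArea_self_left (a b : Plane) : signedArea a b a = 0 := by
  unfold signedArea; ring

lemma signedArea_self_right (a b : Plane) : signedArea a b b = 0 := by
  unfold signedArea; ring

lemma signedArea_combo (x y a b : Plane) {s t : ℝ} (h : s + t = 1) :
    signedArea x y (s • a + t • b) = s * signedArea x y a + t * signedArea x y b := by
  obtain rfl : s = 1 - t := by linarith
  simp only [signedArea, PiLp.add_apply, PiLp.smul_apply, smul_eq_mul]
  ring

lemma convex_signedArea_nonpos (x y : Plane) : Convex ℝ {q | signedArea x y q ≤ 0} := by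
  intro a ha b hb s t hs ht hst
  simp only [Set.mem_ofPred_eq] at *
  rw [signedArea_combo x y a b hst]
  nlinarith [mul_nonneg hs (neg_nonneg.2 ha), mul_nonneg ht (neg_nonneg.2 hb)]

lemma convex_signedArea_pos (x y : Plane) : Convex ℝ {q | 0 < signedArea x y q} := by
  intro a ha b hb s t hs ht hst
  simp only [Set.mem_ofPred_eq] at *
  rw [signedArea_combo x y a b hst]
  rcases hs.eq_or_lt with rfl | hs
  · obtain rfl : t = 1 := by linarith
    simpa using hb
  · nlinarith [mul_pos hs ha, mul_nonneg ht hb.le]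

lemma not_collinear_of_signedArea_ne_zero {a b c : Plane} (h : signedArea a b c ≠ 0) :
    ¬ Collinear ℝ ({a, b, c} : Set Plane) := by
  intro hc
  obtain ⟨w, hw⟩ := (collinear_iff_of_mem (p₀ := a) (by simp)).1 hc
  obtain ⟨s, rfl⟩ := hw b (by simp)
  obtain ⟨t, rfl⟩ := hw c (by simp)
  apply h
  simp [signedArea]
  ring

lemma collinear_of_signedArea_eq_zero {a b c : Plane} (h : signedArea a b c = 0) :
    Collinear ℝ ({a, b, c} : Set Plane) := by
  by_cases hab : a = b
  · subst hab
    simpa using collinear_pair ℝ a c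
  have key : ∃ t : ℝ, c = t • (b - a) + a := by
    simp only [signedArea] at h
    by_cases h0 : b 0 - a 0 = 0
    · have h1 : b 1 - a 1 ≠ 0 := by
        intro h1
        apply hab
        ext i
        fin_cases i
        · simpa using (sub_eq_zero.1 h0).symm
        · simpa using (sub_eq_zero.1 h1).symm
      have h2 : c 0 - a 0 = 0 := by
        rw [h0] at h
        have : (b 1 - a 1) * (c 0 - a 0) = 0 := by linarith
        exact (mul_eq_zero.1 this).resolve_left h1
      refine ⟨(c 1 - a 1) / (b 1 - a 1), ?_⟩
      ext i
      fin_cases i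
      · simp [h0]; linarith
      · simp [div_mul_cancel₀ _ h1]
    · refine ⟨(c 0 - a 0) / (b 0 - a 0), ?_⟩
      ext i
      fin_cases i
      · simp [div_mul_cancel₀ _ h0]
      · simp
        field_simp
        linarith
  obtain ⟨t, ht⟩ := key
  refine (collinear_iff_of_mem (p₀ := a) (by simp)).2 ⟨b - a, ?_⟩
  intro q hq
  simp only [Set.mem_insert_iff, Set.mem_singleton_iff] at hq
  rcases hq with rfl | rfl | rfl
  · exact ⟨0, by simp⟩
  · exact ⟨1, by simp⟩
  · exact ⟨t, by simpa using ht⟩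

/-- The ratios of signed areas are the barycentric coordinates of `q`, and here they are
nonnegative. -/
lemma mem_convexHull_of_signedArea {a b c q : Plane} (h : signedArea a b c < 0)
    (h₁ : signedArea a b q ≤ 0) (h₂ : signedArea b c q ≤ 0) (h₃ : signedArea c a q ≤ 0) :
    q ∈ convexHull ℝ ({a, b, c} : Set Plane) := by
  have hne := h.ne
  have hq : q = (signedArea b c q / signedArea a b c) • a +
      (signedArea c a q / signedArea a b c) • b + (signedArea a b q / signedArea a b c) • c := by
    ext i
    fin_cases i <;> simp <;> field_simp <;> simp only [signedArea] <;> ring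
  rw [hq]
  have hsum : signedArea b c q / signedArea a b c + signedArea c a q / signedArea a b c +
      signedArea a b q / signedArea a b c = 1 := by
    field_simp
    simp only [signedArea]
    ring
  have := (convex_convexHull ℝ ({a, b, c} : Set Plane)).sum_mem (t := Finset.univ)
    (w := ![signedArea b c q / signedArea a b c, signedArea c a q / signedArea a b c,
      signedArea a b q / signedArea a b c]) (z := ![a, b, c])
    (by
      intro i _
      fin_cases i
      · exact div_nonneg_of_nonpos h₂ h.le
      · exact div_nonneg_of_nonpos h₃ h.le
      · exact div_nonneg_of_nonpos h₁ h.le)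
    (by simpa [Fin.sum_univ_three] using hsum)
    (by
      intro i _
      apply subset_convexHull
      fin_cases i <;> simp)
  simpa [Fin.sum_univ_three] using this

lemma signedArea_nonpos_of_mem_convexHull {a b c q : Plane} (h : signedArea a b c ≤ 0)
    (hq : q ∈ convexHull ℝ ({a, b, c} : Set Plane)) :
    signedArea a b q ≤ 0 ∧ signedArea b c q ≤ 0 ∧ signedArea c a q ≤ 0 := by
  refine ⟨convexHull_min ?_ (convex_signedArea_nonpos a b) hq,
    convexHull_min ?_ (convex_signedArea_nonpos b c) hq,
    convexHull_min ?_ (convex_signedArea_nonpos c a) hq⟩ <;>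
  rintro x (rfl | rfl | rfl)
  · exact (signedArea_self_left _ _).le
  · exact (signedArea_self_right _ _).le
  · exact h
  · exact (signedArea_rotate _ _ _).trans_le h
  · exact (signedArea_self_left _ _).le
  · exact (signedArea_self_right _ _).le
  · exact (signedArea_self_right _ _).le
  · exact (signedArea_rotate _ _ _).symm.trans_le h
  · exact (signedArea_self_left _ _).le

/-! ### Pairs of segments -/

lemma edgeSegment_mk (a b : Plane) : edgeSegment s(a, b) = segment ℝ a b := by
  rw [edgeSegment, ← convexHull_pair]
  congr 1
  ext x
  simp

/-- The segments `e` and `e'` are disjoint or meet in exactly one common endpoint. -/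
def MeetProperly (e e' : Sym2 Plane) : Prop :=
  edgeSegment e ∩ edgeSegment e' = ∅ ∨
    ∃ x, x ∈ e ∧ x ∈ e' ∧ edgeSegment e ∩ edgeSegment e' = {x}

lemma MeetProperly.symm {e e' : Sym2 Plane} (h : MeetProperly e e') : MeetProperly e' e := by
  unfold MeetProperly at *
  rw [Set.inter_comm]
  rcases h with h | ⟨x, h₁, h₂, h₃⟩
  · exact Or.inl h
  · exact Or.inr ⟨x, h₂, h₁, h₃⟩

lemma meetProperly_of_common {a b c : Plane} (h : signedArea a b c ≠ 0) :
    MeetProperly s(a, b) s(a, c) := by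
  refine Or.inr ⟨a, by simp, by simp, ?_⟩
  rw [edgeSegment_mk, edgeSegment_mk]
  refine Set.Subset.antisymm ?_
    (Set.singleton_subset_iff.2 ⟨left_mem_segment ℝ a b, left_mem_segment ℝ a c⟩)
  rintro x ⟨⟨s, t, -, -, hst, rfl⟩, s', t', -, -, hst', hx⟩
  -- The function `signedArea a c` vanishes on the second segment, so it forces the coefficient of
  -- `b` to be zero.
  have h₁ := congrArg (signedArea a c) hx
  rw [signedArea_combo _ _ _ _ hst, signedArea_combo _ _ _ _ hst', signedArea_self_left,
    signedArea_self_right, signedArea_swap a b c] at h₁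
  have ht : t = 0 := by
    have : t * signedArea a b c = 0 := by linarith
    exact (mul_eq_zero.1 this).resolve_right h
  have hs : s = 1 := by linarith
  simp [hs, ht]

/-- One half-plane is closed and the other open, so the line `x y` may carry an endpoint of the
first segment, or all of it. -/
lemma meetProperly_of_separated {a b c d x y : Plane} (ha : signedArea x y a ≤ 0)
    (hb : signedArea x y b ≤ 0) (hc : 0 < signedArea x y c) (hd : 0 < signedArea x y d) :
    MeetProperly s(a, b) s(c, d) := by
  refine Or.inl ?_
  rw [edgeSegment_mk, edgeSegment_mk, Set.eq_empty_iff_forall_notMem]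
  rintro q ⟨h₁, h₂⟩
  have h₁ := (convex_signedArea_nonpos x y).segment_subset ha hb h₁
  have h₂ := (convex_signedArea_pos x y).segment_subset hc hd h₂
  exact absurd (Set.mem_ofPred.1 h₂) (not_lt.2 h₁)

lemma not_meetProperly_of_crossing {a b c d : Plane} (hc : signedArea a b c < 0)
    (hd : 0 < signedArea a b d) (ha : 0 < signedArea c d a) (hb : signedArea c d b < 0) :
    ¬ MeetProperly s(a, b) s(c, d) := by
  have hD : 0 < signedArea a b d - signedArea a b c := by linarith
  have hD' : signedArea a b d - signedArea a b c = signedArea c d a - signedArea c d b := by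
    simp only [signedArea]; ring
  rintro (h | ⟨x, hx, hx', -⟩)
  · rw [edgeSegment_mk, edgeSegment_mk, Set.eq_empty_iff_forall_notMem] at h
    -- The point of `c d` at which `signedArea a b` vanishes; by `hD'` the same denominator gives
    -- its coefficients on `a b`.
    refine h ((signedArea a b d / (signedArea a b d - signedArea a b c)) • c +
      (-signedArea a b c / (signedArea a b d - signedArea a b c)) • d) ⟨?_, ?_⟩
    · refine ⟨-signedArea c d b / (signedArea a b d - signedArea a b c),
        signedArea c d a / (signedArea a b d - signedArea a b c),
        div_nonneg (by linarith) hD.le, div_nonneg ha.le hD.le, ?_, ?_⟩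
      · rw [← add_div, div_eq_one_iff_eq hD.ne', hD']; ring
      · ext i
        fin_cases i <;> simp <;> field_simp <;> simp only [signedArea] <;> ring
    · refine ⟨_, _, div_nonneg hd.le hD.le, div_nonneg (by linarith) hD.le, ?_, rfl⟩
      rw [← add_div, div_eq_one_iff_eq hD.ne']; ring
  · simp only [Sym2.mem_iff] at hx hx'
    rcases hx with rfl | rfl <;> rcases hx' with rfl | rfl <;>
      simp [signedArea_self_left, signedArea_self_right] at hc hd

/-! ### Suspensions of paths -/

/-- `u` and `v` see the points `p 0, p 1, …`, all on one side of the line `u v`, in opposite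
radial orders, and the latter are in general position. -/
structure IsSuspension {n : ℕ} (u v : Plane) (p : Fin n → Plane) : Prop where
  ne : u ≠ v
  base_pos : ∀ i, 0 < signedArea u v (p i)
  top_pos : ∀ i j, i < j → 0 < signedArea u (p i) (p j)
  bot_neg : ∀ i j, i < j → signedArea v (p i) (p j) < 0
  path_ne_zero : ∀ i j k, i ≠ j → j ≠ k → i ≠ k → signedArea (p i) (p j) (p k) ≠ 0

/-- The vertices of the suspension of a path with `n` vertices. -/
inductive SuspensionVertex (n : ℕ) : Type
  | top : SuspensionVertex n
  | bot : SuspensionVertex n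
  | mid (i : Fin n) : SuspensionVertex n

open SuspensionVertex

/-- The points represented by the vertices of a suspension. -/
def suspensionPoint {n : ℕ} (u v : Plane) (p : Fin n → Plane) : SuspensionVertex n → Plane
  | top => u
  | bot => v
  | mid i => p i

/-- Adjacency in the suspension of a path. -/
def SuspensionAdj {n : ℕ} : SuspensionVertex n → SuspensionVertex n → Prop
  | top, top => False
  | bot, bot => False
  | mid i, mid j => i.1 + 1 = j.1 ∨ j.1 + 1 = i.1
  | _, _ => True

/-- The segments that represent the suspension of a path. -/
def suspensionEdges {n : ℕ} (u v : Plane) (p : Fin n → Plane) : Set (Sym2 Plane) :=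
  {e | ∃ x y, SuspensionAdj x y ∧ e = s(suspensionPoint u v p x, suspensionPoint u v p y)}

lemma suspensionEdges_cases {n : ℕ} {u v : Plane} {p : Fin n → Plane} {e : Sym2 Plane}
    (he : e ∈ suspensionEdges u v p) :
    e = s(u, v) ∨ (∃ i, e = s(u, p i)) ∨ (∃ i, e = s(v, p i)) ∨
      ∃ i j : Fin n, i.1 + 1 = j.1 ∧ e = s(p i, p j) := by
  obtain ⟨x, y, h, rfl⟩ := he
  rcases x with _ | _ | i <;> rcases y with _ | _ | j <;>
    simp only [SuspensionAdj, suspensionPoint] at h ⊢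
  · exact Or.inl trivial
  · exact Or.inr (Or.inl ⟨j, rfl⟩)
  · exact Or.inl Sym2.eq_swap
  · exact Or.inr (Or.inr (Or.inl ⟨j, rfl⟩))
  · exact Or.inr (Or.inl ⟨i, Sym2.eq_swap⟩)
  · exact Or.inr (Or.inr (Or.inl ⟨i, Sym2.eq_swap⟩))
  · rcases h with h | h
    · exact Or.inr (Or.inr (Or.inr ⟨i, j, h, rfl⟩))
    · exact Or.inr (Or.inr (Or.inr ⟨j, i, h, Sym2.eq_swap⟩))

lemma isClockwiseTriangle_rotate {S : Set Plane} {E : Set (Sym2 Plane)} {a b c : Plane} :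
    IsClockwiseTriangle S E b c a ↔ IsClockwiseTriangle S E a b c := by
  have key : ∀ {a b c : Plane}, IsClockwiseTriangle S E a b c →
      IsClockwiseTriangle S E b c a := by
    intro a b c h
    refine ⟨h.2, h.3, h.1, h.5, h.6, h.4, ?_, ?_⟩
    · rw [signedArea_rotate]; exact h.7
    · intro p hp hp'
      have hs : ({b, c, a} : Set Plane) = {a, b, c} := by
        ext; simp; tauto
      rw [hs] at hp'
      rcases h.8 p hp hp' with h | h | h <;> simp [h]
  exact ⟨fun h => key (key h), key⟩

namespace IsSuspension

variable {n : ℕ} {u v : Plane} {p : Fin n → Plane}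

/-! ### Distinct vertices and general position -/

lemma top_ne_mid (h : IsSuspension u v p) (i : Fin n) : u ≠ p i := by
  intro e
  have := h.base_pos i
  rw [← e, signedArea_self_left] at this
  exact this.false

lemma bot_ne_mid (h : IsSuspension u v p) (i : Fin n) : v ≠ p i := by
  intro e
  have := h.base_pos i
  rw [← e, signedArea_self_right] at this
  exact this.false

lemma mid_injective (h : IsSuspension u v p) : Function.Injective p := by
  intro i j e
  by_contra hij
  rcases lt_or_gt_of_ne hij with hlt | hlt
  · have := h.top_pos i j hlt
    rw [e, signedArea_self_right] at this
    exact this.false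
  · have := h.top_pos j i hlt
    rw [e, signedArea_self_right] at this
    exact this.false

lemma point_injective (h : IsSuspension u v p) :
    Function.Injective (suspensionPoint u v p) := by
  intro x y e
  rcases x with _ | _ | i <;> rcases y with _ | _ | j <;> simp only [suspensionPoint] at e
  · rfl
  · exact absurd e h.ne
  · exact absurd e (h.top_ne_mid j)
  · exact absurd e.symm h.ne
  · rfl
  · exact absurd e (h.bot_ne_mid j)
  · exact absurd e.symm (h.top_ne_mid i)
  · exact absurd e.symm (h.bot_ne_mid i)
  · rw [h.mid_injective e]

lemma top_ne_zero (h : IsSuspension u v p) {i j : Fin n} (hij : i ≠ j) :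
    signedArea u (p i) (p j) ≠ 0 := by
  rcases lt_or_gt_of_ne hij with hlt | hlt
  · exact (h.top_pos i j hlt).ne'
  · rw [signedArea_swap]
    exact neg_ne_zero.2 (h.top_pos j i hlt).ne'

lemma bot_ne_zero (h : IsSuspension u v p) {i j : Fin n} (hij : i ≠ j) :
    signedArea v (p i) (p j) ≠ 0 := by
  rcases lt_or_gt_of_ne hij with hlt | hlt
  · exact (h.bot_neg i j hlt).ne
  · rw [signedArea_swap]
    exact neg_ne_zero.2 (h.bot_neg j i hlt).ne

lemma signedArea_ne_zero (h : IsSuspension u v p) {x y z : SuspensionVertex n} (hxy : x ≠ y)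
    (hyz : y ≠ z) (hxz : x ≠ z) : signedArea (suspensionPoint u v p x)
      (suspensionPoint u v p y) (suspensionPoint u v p z) ≠ 0 := by
  have hb := fun i => (h.base_pos i).ne'
  have hb' : ∀ i, signedArea v u (p i) ≠ 0 := fun i => by
    rw [← signedArea_rotate, signedArea_swap]
    exact neg_ne_zero.2 (hb i)
  rcases x with _ | _ | i <;> rcases y with _ | _ | j <;> rcases z with _ | _ | k <;>
    simp only [suspensionPoint, ne_eq, not_true_eq_false, reduceCtorEq, not_false_eq_true,
      mid.injEq] at hxy hyz hxz ⊢
  · exact hb k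
  · rw [← signedArea_rotate, ← signedArea_rotate]; exact hb' j
  · exact h.top_ne_zero hyz
  · exact hb' k
  · rw [← signedArea_rotate, ← signedArea_rotate]; exact hb j
  · exact h.bot_ne_zero hyz
  · rw [← signedArea_rotate]; exact hb i
  · rw [← signedArea_rotate]; exact h.top_ne_zero (Ne.symm hxz)
  · rw [← signedArea_rotate]; exact hb' i
  · rw [← signedArea_rotate]; exact h.bot_ne_zero (Ne.symm hxz)
  · rw [← signedArea_rotate, ← signedArea_rotate]; exact h.top_ne_zero hxy
  · rw [← signedArea_rotate, ← signedArea_rotate]; exact h.bot_ne_zero hxy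
  · exact h.path_ne_zero i j k hxy hyz hxz

lemma inGeneralPosition (h : IsSuspension u v p) :
    InGeneralPosition (Set.range (suspensionPoint u v p)) := by
  rintro _ ⟨x, rfl⟩ _ ⟨y, rfl⟩ _ ⟨z, rfl⟩ hxy hyz hxz
  exact not_collinear_of_signedArea_ne_zero (h.signedArea_ne_zero (ne_of_apply_ne _ hxy)
    (ne_of_apply_ne _ hyz) (ne_of_apply_ne _ hxz))

lemma mem_edges_iff (h : IsSuspension u v p) (x y : SuspensionVertex n) :
    s(suspensionPoint u v p x, suspensionPoint u v p y) ∈ suspensionEdges u v p ↔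
      SuspensionAdj x y := by
  refine ⟨?_, fun hxy => ⟨x, y, hxy, rfl⟩⟩
  rintro ⟨x', y', hxy, e⟩
  rcases Sym2.eq_iff.1 e with ⟨h₁, h₂⟩ | ⟨h₁, h₂⟩
  · rwa [h.point_injective h₁, h.point_injective h₂]
  · rw [h.point_injective h₁, h.point_injective h₂]
    rcases x' with _ | _ | i <;> rcases y' with _ | _ | j <;>
      simp only [SuspensionAdj] at hxy ⊢
    exact hxy.symm

lemma meetProperly_of_vertex (h : IsSuspension u v p) {x y z : SuspensionVertex n}
    (hxy : x ≠ y) (hyz : y ≠ z) (hxz : x ≠ z) :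
    MeetProperly s(suspensionPoint u v p x, suspensionPoint u v p y)
      s(suspensionPoint u v p x, suspensionPoint u v p z) :=
  meetProperly_of_common (h.signedArea_ne_zero hxy hyz hxz)

/-! ### Noncrossing edges -/

lemma meetProperly_base_top (h : IsSuspension u v p) (i : Fin n) :
    MeetProperly s(u, v) s(u, p i) :=
  h.meetProperly_of_vertex (x := top) (y := bot) (z := mid i) (by simp) (by simp) (by simp)

lemma meetProperly_base_bot (h : IsSuspension u v p) (i : Fin n) :
    MeetProperly s(u, v) s(v, p i) := by
  rw [Sym2.eq_swap]
  exact h.meetProperly_of_vertex (x := bot) (y := top) (z := mid i) (by simp) (by simp) (by simp)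

lemma meetProperly_base_mid (h : IsSuspension u v p) (i j : Fin n) :
    MeetProperly s(u, v) s(p i, p j) :=
  meetProperly_of_separated (signedArea_self_left u v).le (signedArea_self_right u v).le
    (h.base_pos i) (h.base_pos j)

lemma meetProperly_top_top (h : IsSuspension u v p) {i j : Fin n} (hij : i ≠ j) :
    MeetProperly s(u, p i) s(u, p j) :=
  h.meetProperly_of_vertex (x := top) (y := mid i) (z := mid j) (by simp) (by simpa) (by simp)

lemma meetProperly_bot_bot (h : IsSuspension u v p) {i j : Fin n} (hij : i ≠ j) :
    MeetProperly s(v, p i) s(v, p j) :=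
  h.meetProperly_of_vertex (x := bot) (y := mid i) (z := mid j) (by simp) (by simpa) (by simp)

/-- For distinct indices, the line through the later point and the apex joined to it has the other
edge strictly on one side. For equal indices the edges share `p i`. -/
lemma meetProperly_top_bot (h : IsSuspension u v p) (i j : Fin n) :
    MeetProperly s(u, p i) s(v, p j) := by
  rcases lt_trichotomy i j with hij | rfl | hij
  · refine (meetProperly_of_separated (x := v) (y := p j) (signedArea_self_left _ _).le
      (signedArea_self_right _ _).le ?_ ?_).symm
    · rw [signedArea_rotate]; exact h.base_pos j
    · rw [signedArea_swap]; exact neg_pos.2 (h.bot_neg i j hij)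
  · rw [Sym2.eq_swap, Sym2.eq_swap (a := v)]
    exact h.meetProperly_of_vertex (x := mid i) (y := top) (z := bot)
      (by simp) (by simp) (by simp)
  · refine meetProperly_of_separated (x := p i) (y := u) (signedArea_self_right _ _).le
      (signedArea_self_left _ _).le ?_ ?_
    · rw [← signedArea_rotate]; exact h.base_pos i
    · rw [← signedArea_rotate]; exact h.top_pos j i hij

lemma meetProperly_mid_common (h : IsSuspension u v p) {x : SuspensionVertex n}
    {i j : Fin n} (hx : ∀ k, x ≠ mid k) (hij : i ≠ j) :
    MeetProperly s(suspensionPoint u v p x, p i) s(p i, p j) := by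
  rw [Sym2.eq_swap]
  exact h.meetProperly_of_vertex (x := mid i) (y := x) (z := mid j) (hx i).symm (hx j) (by simpa)

lemma meetProperly_top_mid (h : IsSuspension u v p) (i : Fin n) {j k : Fin n}
    (hjk : j.1 + 1 = k.1) : MeetProperly s(u, p i) s(p j, p k) := by
  have hlt : j < k := by rw [Fin.lt_def]; omega
  rcases lt_trichotomy i j with hij | rfl | hij
  · exact meetProperly_of_separated (x := u) (y := p i) (signedArea_self_left _ _).le
      (signedArea_self_right _ _).le (h.top_pos i j hij) (h.top_pos i k (hij.trans hlt))
  · exact h.meetProperly_mid_common (x := top) (by simp) hlt.ne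
  · rcases eq_or_ne i k with rfl | hik
    · rw [Sym2.eq_swap (a := p j)]
      exact h.meetProperly_mid_common (x := top) (by simp) hlt.ne'
    · have hki : k < i := by rw [Fin.lt_def] at *; omega
      refine meetProperly_of_separated (x := p i) (y := u) (signedArea_self_right _ _).le
        (signedArea_self_left _ _).le ?_ ?_ <;> rw [← signedArea_rotate]
      · exact h.top_pos j i hij
      · exact h.top_pos k i hki

lemma meetProperly_bot_mid (h : IsSuspension u v p) (i : Fin n) {j k : Fin n}
    (hjk : j.1 + 1 = k.1) : MeetProperly s(v, p i) s(p j, p k) := by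
  have hlt : j < k := by rw [Fin.lt_def]; omega
  rcases lt_trichotomy i j with hij | rfl | hij
  · refine meetProperly_of_separated (x := p i) (y := v) (signedArea_self_right _ _).le
      (signedArea_self_left _ _).le ?_ ?_ <;> rw [← signedArea_rotate, signedArea_swap, neg_pos]
    · exact h.bot_neg i j hij
    · exact h.bot_neg i k (hij.trans hlt)
  · exact h.meetProperly_mid_common (x := bot) (by simp) hlt.ne
  · rcases eq_or_ne i k with rfl | hik
    · rw [Sym2.eq_swap (a := p j)]
      exact h.meetProperly_mid_common (x := bot) (by simp) hlt.ne'
    · have hki : k < i := by rw [Fin.lt_def] at *; omega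
      refine meetProperly_of_separated (x := v) (y := p i) (signedArea_self_left _ _).le
        (signedArea_self_right _ _).le ?_ ?_ <;> rw [signedArea_swap, neg_pos]
      · exact h.bot_neg j i hij
      · exact h.bot_neg k i hki

/-- The path is monotone in the radial order around `u`, so the ray from `u` through `p j` separates
edges without a common vertex. -/
lemma meetProperly_mid_mid_of_lt (h : IsSuspension u v p) {i j k l : Fin n}
    (hij : i.1 + 1 = j.1) (hkl : k.1 + 1 = l.1) (hik : i < k) :
    MeetProperly s(p i, p j) s(p k, p l) := by
  have hij' : i < j := by rw [Fin.lt_def]; omega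
  have hkl' : k < l := by rw [Fin.lt_def]; omega
  rcases eq_or_ne j k with rfl | hjk
  · rw [Sym2.eq_swap]
    exact h.meetProperly_of_vertex (x := mid j) (y := mid i) (z := mid l)
      (by simpa using hij'.ne') (by simpa using (hij'.trans hkl').ne) (by simpa using hkl'.ne)
  · have hjk' : j < k := by rw [Fin.lt_def] at *; omega
    refine meetProperly_of_separated (x := u) (y := p j) ?_ (signedArea_self_right _ _).le
      (h.top_pos j k hjk') (h.top_pos j l (hjk'.trans hkl'))
    rw [signedArea_swap]
    exact (neg_neg_of_pos (h.top_pos i j hij')).le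

lemma meetProperly_mid_mid (h : IsSuspension u v p) {i j k l : Fin n}
    (hij : i.1 + 1 = j.1) (hkl : k.1 + 1 = l.1) (hik : i ≠ k) :
    MeetProperly s(p i, p j) s(p k, p l) := by
  rcases lt_or_gt_of_ne hik with hlt | hlt
  · exact h.meetProperly_mid_mid_of_lt hij hkl hlt
  · exact (h.meetProperly_mid_mid_of_lt hkl hij hlt).symm

lemma isNoncrossing (h : IsSuspension u v p) :
    IsNoncrossing (Set.range (suspensionPoint u v p)) (suspensionEdges u v p) := by
  refine ⟨?_, ?_, ?_⟩
  · rintro _ ⟨x, y, hxy, rfl⟩ hd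
    have := h.point_injective (Sym2.mk_isDiag_iff.1 hd)
    subst this
    rcases x with _ | _ | i <;> simp [SuspensionAdj] at hxy
  · rintro _ ⟨x, y, hxy, rfl⟩ z hz
    rcases Sym2.mem_iff.1 hz with rfl | rfl
    · exact ⟨x, rfl⟩
    · exact ⟨y, rfl⟩
  · intro e he e' he' hne
    change MeetProperly e e'
    rcases suspensionEdges_cases he with rfl | ⟨i, rfl⟩ | ⟨i, rfl⟩ | ⟨i, j, hij, rfl⟩ <;>
      rcases suspensionEdges_cases he' with rfl | ⟨k, rfl⟩ | ⟨k, rfl⟩ | ⟨k, l, hkl, rfl⟩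
    · exact absurd rfl hne
    · exact h.meetProperly_base_top k
    · exact h.meetProperly_base_bot k
    · exact h.meetProperly_base_mid k l
    · exact (h.meetProperly_base_top i).symm
    · exact h.meetProperly_top_top (by rintro rfl; exact hne rfl)
    · exact h.meetProperly_top_bot i k
    · exact h.meetProperly_top_mid i hkl
    · exact (h.meetProperly_base_bot i).symm
    · exact (h.meetProperly_top_bot k i).symm
    · exact h.meetProperly_bot_bot (by rintro rfl; exact hne rfl)
    · exact h.meetProperly_bot_mid i hkl
    · exact (h.meetProperly_base_mid i j).symm
    · exact (h.meetProperly_top_mid k hij).symm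
    · exact (h.meetProperly_bot_mid k hij).symm
    · refine h.meetProperly_mid_mid hij hkl ?_
      rintro rfl
      obtain rfl : j = l := Fin.ext (by omega)
      exact hne rfl

/-! ### Maximality -/

lemma exists_crossing (h : IsSuspension u v p) {i j : Fin n} (hij : i.1 + 1 < j.1) :
    ∃ e ∈ suspensionEdges u v p, s(p i, p j) ≠ e ∧ ¬ MeetProperly s(p i, p j) e := by
  obtain ⟨k, hik, hkj⟩ : ∃ k : Fin n, i < k ∧ k < j :=
    ⟨⟨i.1 + 1, hij.trans j.2⟩, by simp [Fin.lt_def], by simpa [Fin.lt_def] using hij⟩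
  -- The apexes lie on opposite sides of the line `p i`, `p j`; the one not on the side of `p k` is
  -- chosen.
  have hlt := hik.trans hkj
  rcases lt_or_gt_of_ne (h.path_ne_zero i j k hlt.ne hkj.ne' hik.ne) with hs | hs
  · refine ⟨s(p k, u), ⟨mid k, top, trivial, rfl⟩, ?_,
      not_meetProperly_of_crossing hs ?_ ?_ ?_⟩
    · intro e
      have : u ∈ s(p i, p j) := e ▸ Sym2.mem_mk_right _ _
      rcases Sym2.mem_iff.1 this with e | e
      · exact h.top_ne_mid i e
      · exact h.top_ne_mid j e
    · rw [signedArea_rotate]; exact h.top_pos i j hlt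
    · rw [← signedArea_rotate, ← signedArea_rotate, signedArea_rotate]
      exact h.top_pos i k hik
    · rw [← signedArea_rotate, signedArea_swap, neg_neg_iff_pos]; exact h.top_pos k j hkj
  · refine ⟨s(v, p k), ⟨bot, mid k, trivial, rfl⟩, ?_,
      not_meetProperly_of_crossing ?_ hs ?_ (h.bot_neg k j hkj)⟩
    · intro e
      have : v ∈ s(p i, p j) := e ▸ Sym2.mem_mk_left _ _
      rcases Sym2.mem_iff.1 this with e | e
      · exact h.bot_ne_mid i e
      · exact h.bot_ne_mid j e
    · rw [signedArea_rotate]; exact h.bot_neg i j hlt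
    · rw [signedArea_swap, neg_pos]; exact h.bot_neg i k hik

/-- Only chords between nonconsecutive path points are not yet edges, so a larger noncrossing set
would have to contain one of them. -/
lemma isTriangulation (h : IsSuspension u v p) :
    IsTriangulation (Set.range (suspensionPoint u v p)) (suspensionEdges u v p) := by
  refine ⟨h.isNoncrossing, ?_⟩
  intro E hE hsub e he
  have hcross : ∀ i j : Fin n, i.1 + 1 < j.1 → s(p i, p j) ∉ E := by
    intro i j hij hmem
    obtain ⟨e, he, hne, hc⟩ := h.exists_crossing hij
    exact hc (hE.inter _ hmem _ (hsub he) hne)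
  induction e with | _ a b
  obtain ⟨x, rfl⟩ := hE.endpoint_mem _ he a (by simp)
  obtain ⟨y, rfl⟩ := hE.endpoint_mem _ he b (by simp)
  have hxy : x ≠ y := by
    rintro rfl
    exact hE.not_isDiag _ he (by simp)
  refine ⟨x, y, ?_, rfl⟩
  rcases x with _ | _ | i <;> rcases y with _ | _ | j <;> simp only [SuspensionAdj]
  · exact hxy rfl
  · exact hxy rfl
  · have h₁ : ¬ i.1 + 1 < j.1 := fun hlt => hcross i j hlt he
    have h₂ : ¬ j.1 + 1 < i.1 := fun hlt => hcross j i hlt (Sym2.eq_swap ▸ he)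
    have h₃ : i.1 ≠ j.1 := fun e => hxy (by rw [Fin.ext e])
    omega

/-! ### The clockwise triangles of a suspension -/

/-- `x`, `y`, `z` represent a clockwise triangle of the suspension. -/
abbrev IsTri (u v : Plane) (p : Fin n → Plane) (x y z : SuspensionVertex n) : Prop :=
  IsClockwiseTriangle (Set.range (suspensionPoint u v p)) (suspensionEdges u v p)
    (suspensionPoint u v p x) (suspensionPoint u v p y) (suspensionPoint u v p z)

lemma isTri_top_mid_mid_iff (h : IsSuspension u v p) (i j : Fin n) :
    IsTri u v p top (mid i) (mid j) ↔ j.1 + 1 = i.1 := by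
  constructor
  · intro ht
    rcases (h.mem_edges_iff (mid i) (mid j)).1 ht.side_bc with hij | hij
    · exact absurd ht.clockwise (not_lt.2 (h.top_pos i j (by rw [Fin.lt_def]; omega)).le)
    · exact hij
  · intro hij
    have hlt : j < i := by rw [Fin.lt_def]; omega
    have hs : signedArea u (p i) (p j) < 0 := by
      rw [signedArea_swap]; exact neg_neg_of_pos (h.top_pos j i hlt)
    refine ⟨⟨top, rfl⟩, ⟨mid i, rfl⟩, ⟨mid j, rfl⟩, ⟨top, mid i, trivial, rfl⟩,
      ⟨mid i, mid j, Or.inr hij, rfl⟩, ⟨mid j, top, trivial, rfl⟩, hs, ?_⟩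
    rintro _ ⟨x, rfl⟩ hx
    obtain ⟨h₁, -, h₃⟩ := signedArea_nonpos_of_mem_convexHull hs.le hx
    rw [← signedArea_rotate] at h₃
    rcases x with _ | _ | k
    · exact Or.inl rfl
    · exact absurd (h.base_pos j) (not_lt.2 h₃)
    · have h₄ : ¬ i < k := fun hik => absurd (h.top_pos i k hik) (not_lt.2 h₁)
      have h₅ : ¬ k < j := fun hkj => absurd (h.top_pos k j hkj) (not_lt.2 h₃)
      rw [Fin.lt_def] at h₄ h₅
      have h₆ : k = i ∨ k = j := by rw [Fin.ext_iff, Fin.ext_iff]; omega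
      rcases h₆ with rfl | rfl
      · exact Or.inr (Or.inl rfl)
      · exact Or.inr (Or.inr rfl)

lemma isTri_bot_mid_mid_iff (h : IsSuspension u v p) (i j : Fin n) :
    IsTri u v p bot (mid i) (mid j) ↔ i.1 + 1 = j.1 := by
  constructor
  · intro ht
    rcases (h.mem_edges_iff (mid i) (mid j)).1 ht.side_bc with hij | hij
    · exact hij
    · have hs : signedArea v (p i) (p j) < 0 := ht.clockwise
      rw [signedArea_swap, neg_lt_zero] at hs
      exact absurd hs (not_lt.2 (h.bot_neg j i (by rw [Fin.lt_def]; omega)).le)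
  · intro hij
    have hlt : i < j := by rw [Fin.lt_def]; omega
    have hs := h.bot_neg i j hlt
    refine ⟨⟨bot, rfl⟩, ⟨mid i, rfl⟩, ⟨mid j, rfl⟩, ⟨bot, mid i, trivial, rfl⟩,
      ⟨mid i, mid j, Or.inl hij, rfl⟩, ⟨mid j, bot, trivial, rfl⟩, hs, ?_⟩
    rintro _ ⟨x, rfl⟩ hx
    obtain ⟨h₁, -, h₃⟩ := signedArea_nonpos_of_mem_convexHull hs.le hx
    rcases x with _ | _ | k
    · have h₁ : signedArea v (p i) u ≤ 0 := h₁
      rw [signedArea_rotate] at h₁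
      exact absurd (h.base_pos i) (not_lt.2 h₁)
    · exact Or.inl rfl
    · have h₄ : ¬ k < i := fun hki => by
        rw [signedArea_swap] at h₁
        exact absurd (h.bot_neg k i hki) (not_lt.2 (neg_nonpos.1 h₁))
      have h₅ : ¬ j < k := fun hjk => by
        rw [← signedArea_rotate, signedArea_swap] at h₃
        exact absurd (h.bot_neg j k hjk) (not_lt.2 (neg_nonpos.1 h₃))
      rw [Fin.lt_def] at h₄ h₅
      have h₆ : k = i ∨ k = j := by rw [Fin.ext_iff, Fin.ext_iff]; omega
      rcases h₆ with rfl | rfl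
      · exact Or.inr (Or.inl rfl)
      · exact Or.inr (Or.inr rfl)

/-- All three sides are edges for every `i`, so emptiness decides: the triangle contains `p 0`, the
path point nearest to the base in both radial orders. -/
lemma isTri_top_mid_bot_iff (h : IsSuspension u v p) (i : Fin n) :
    IsTri u v p top (mid i) bot ↔ i.1 = 0 := by
  have hs : signedArea u (p i) v < 0 := by
    rw [signedArea_swap]; exact neg_neg_of_pos (h.base_pos i)
  constructor
  · intro ht
    by_contra hi
    let o : Fin n := ⟨0, i.pos⟩
    have hlt : o < i := by rw [Fin.lt_def]; exact Nat.pos_of_ne_zero hi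
    have hmem : p o ∈ convexHull ℝ ({u, p i, v} : Set Plane) := by
      apply mem_convexHull_of_signedArea hs
      · rw [signedArea_swap]; exact (neg_neg_of_pos (h.top_pos o i hlt)).le
      · rw [← signedArea_rotate]
        exact (h.bot_neg o i hlt).le
      · rw [← signedArea_rotate, signedArea_swap]
        exact (neg_neg_of_pos (h.base_pos o)).le
    rcases ht.empty (p o) ⟨mid o, rfl⟩ hmem with e | e | e
    · exact h.top_ne_mid o e.symm
    · exact hlt.ne (h.mid_injective e)
    · exact h.bot_ne_mid o e.symm
  · intro hi
    refine ⟨⟨top, rfl⟩, ⟨mid i, rfl⟩, ⟨bot, rfl⟩, ⟨top, mid i, trivial, rfl⟩,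
      ⟨mid i, bot, trivial, rfl⟩, ⟨bot, top, trivial, rfl⟩, hs, ?_⟩
    rintro _ ⟨x, rfl⟩ hx
    obtain ⟨h₁, -, -⟩ := signedArea_nonpos_of_mem_convexHull hs.le hx
    rcases x with _ | _ | k
    · exact Or.inl rfl
    · exact Or.inr (Or.inr rfl)
    · have h₄ : ¬ i < k := fun hik => absurd (h.top_pos i k hik) (not_lt.2 h₁)
      rw [Fin.lt_def] at h₄
      obtain rfl : k = i := Fin.ext (by omega)
      exact Or.inr (Or.inl rfl)

lemma not_isTri_top_bot_mid (h : IsSuspension u v p) (i : Fin n) :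
    ¬ IsTri u v p top bot (mid i) :=
  fun ht => absurd ht.clockwise (not_lt.2 (h.base_pos i).le)

lemma IsTri.rotate {x y z : SuspensionVertex n} (h : IsTri u v p x y z) : IsTri u v p y z x :=
  isClockwiseTriangle_rotate.2 h

lemma isTri_of_isTri {u' v' : Plane} {p' : Fin n → Plane} (h : IsSuspension u v p)
    (h' : IsSuspension u' v' p') {x y z : SuspensionVertex n} (ht : IsTri u v p x y z) :
    IsTri u' v' p' x y z := by
  have hxy := (h.mem_edges_iff _ _).1 ht.side_ab
  have hyz := (h.mem_edges_iff _ _).1 ht.side_bc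
  have hzx := (h.mem_edges_iff _ _).1 ht.side_ca
  have htop : ∀ i j, IsTri u v p top (mid i) (mid j) → IsTri u' v' p' top (mid i) (mid j) :=
    fun i j ht => (h'.isTri_top_mid_mid_iff i j).2 ((h.isTri_top_mid_mid_iff i j).1 ht)
  have hbot : ∀ i j, IsTri u v p bot (mid i) (mid j) → IsTri u' v' p' bot (mid i) (mid j) :=
    fun i j ht => (h'.isTri_bot_mid_mid_iff i j).2 ((h.isTri_bot_mid_mid_iff i j).1 ht)
  have hbase : ∀ i, IsTri u v p top (mid i) bot → IsTri u' v' p' top (mid i) bot :=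
    fun i ht => (h'.isTri_top_mid_bot_iff i).2 ((h.isTri_top_mid_bot_iff i).1 ht)
  rcases x with _ | _ | i <;> rcases y with _ | _ | j <;> rcases z with _ | _ | k <;>
    simp only [SuspensionAdj] at hxy hyz hzx
  · exact absurd ht (h.not_isTri_top_bot_mid k)
  · exact hbase j ht
  · exact htop j k ht
  · exact (hbase k ht.rotate).rotate.rotate
  · exact absurd ht.rotate.rotate (h.not_isTri_top_bot_mid j)
  · exact hbot j k ht
  · exact absurd ht.rotate (h.not_isTri_top_bot_mid i)
  · exact (htop k i ht.rotate).rotate.rotate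
  · exact (hbase i ht.rotate.rotate).rotate
  · exact (hbot k i ht.rotate).rotate.rotate
  · exact (htop i j ht.rotate.rotate).rotate
  · exact (hbot i j ht.rotate.rotate).rotate
  -- A path has no three pairwise adjacent vertices.
  · omega

lemma range_suspensionPoint : Set.range (suspensionPoint u v p) = Set.range p ∪ {u, v} := by
  ext q
  constructor
  · rintro ⟨_ | _ | i, rfl⟩
    · exact Or.inr (Or.inl rfl)
    · exact Or.inr (Or.inr rfl)
    · exact Or.inl ⟨i, rfl⟩
  · rintro (⟨i, rfl⟩ | rfl | rfl)
    · exact ⟨mid i, rfl⟩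
    · exact ⟨top, rfl⟩
    · exact ⟨bot, rfl⟩

lemma disjoint (h : IsSuspension u v p) : Disjoint (Set.range p) {u, v} := by
  rw [Set.disjoint_left]
  rintro _ ⟨i, rfl⟩ (e | e)
  · exact h.top_ne_mid i e.symm
  · exact h.bot_ne_mid i e.symm

end IsSuspension

/-- Suspensions of paths of the same length are compatible. -/
theorem exists_compatibleVia {n : ℕ} {u v u' v' : Plane} {p p' : Fin n → Plane}
    (h : IsSuspension u v p) (h' : IsSuspension u' v' p') :
    ∃ f : Plane → Plane,
      CompatibleVia (Set.range (suspensionPoint u v p)) (suspensionEdges u v p)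
        (Set.range (suspensionPoint u' v' p')) (suspensionEdges u' v' p') f ∧
      Set.BijOn f (Set.range p) (Set.range p') ∧ Set.BijOn f {u, v} {u', v'} := by
  have : Nonempty (SuspensionVertex n) := ⟨top⟩
  -- Only the values at represented points matter; elsewhere `Function.invFun` gives an arbitrary
  -- vertex.
  let f : Plane → Plane :=
    fun q => suspensionPoint u' v' p' (Function.invFun (suspensionPoint u v p) q)
  have hf : ∀ x, f (suspensionPoint u v p x) = suspensionPoint u' v' p' x := fun x => by
    simp only [f, Function.leftInverse_invFun h.point_injective x]
  have hinj : Set.InjOn f (Set.range (suspensionPoint u v p)) := by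
    rintro _ ⟨x, rfl⟩ _ ⟨y, rfl⟩ e
    rw [hf, hf] at e
    rw [h'.point_injective e]
  refine ⟨f, ⟨?_, ?_⟩, ?_, ?_⟩
  · convert hinj.bijOn_image
    rw [← Set.range_comp]
    exact congrArg Set.range (funext fun x => (hf x).symm)
  · rintro _ ⟨x, rfl⟩ _ ⟨y, rfl⟩ _ ⟨z, rfl⟩
    rw [hf, hf, hf]
    exact ⟨h.isTri_of_isTri h', h'.isTri_of_isTri h⟩
  · rw [IsSuspension.range_suspensionPoint] at hinj
    convert (hinj.mono Set.subset_union_left).bijOn_image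
    rw [← Set.range_comp]
    exact congrArg Set.range (funext fun i => (hf (mid i)).symm)
  · rw [IsSuspension.range_suspensionPoint] at hinj
    convert (hinj.mono Set.subset_union_right).bijOn_image
    rw [Set.image_pair]
    exact congrArg₂ _ (hf top).symm (congrArg _ (hf bot).symm)

/-! ### Existence -/

lemma exists_slope_injOn {S : Set Plane} (hS : S.Finite) :
    ∃ t : ℝ, Set.InjOn (fun q : Plane => q 0 * t - q 1) S := by
  -- The slope `t` avoids those of all lines through two points of `S`. Vertical pairs give the junk
  -- value `0`, which is harmless to avoid, and any `t` separates them.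
  obtain ⟨t, ht⟩ := ((hS.prod hS).image
    fun q : Plane × Plane => (q.1 1 - q.2 1) / (q.1 0 - q.2 0)).exists_notMem
  refine ⟨t, fun a ha b hb e => ?_⟩
  by_contra hab
  have e : a 0 * t - a 1 = b 0 * t - b 1 := e
  by_cases h0 : a 0 - b 0 = 0
  · apply hab
    have h0 : a 0 = b 0 := sub_eq_zero.1 h0
    rw [h0] at e
    ext i
    fin_cases i
    · exact h0
    · change a 1 = b 1
      linarith
  · refine ht ⟨(a, b), ⟨ha, hb⟩, ?_⟩
    change (a 1 - b 1) / (a 0 - b 0) = t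
    rw [div_eq_iff h0]
    linarith

lemma exists_strictMono_enumeration {α : Type*} {S : Set α} (hS : S.Finite) {n : ℕ}
    (hn : S.ncard = n) {k : α → ℝ} (hk : Set.InjOn k S) :
    ∃ p : Fin n → α, Set.range p = S ∧ StrictMono (k ∘ p) := by
  classical
  have hcard : (hS.toFinset.image k).card = n := by
    rw [Finset.card_image_of_injOn (by simpa using hk), ← Set.ncard_eq_toFinset_card S hS, hn]
  let e := (hS.toFinset.image k).orderEmbOfFin hcard
  have he : ∀ i, ∃ s ∈ S, k s = e i := fun i => by
    obtain ⟨s, hs, hk⟩ := Finset.mem_image.1 (Finset.orderEmbOfFin_mem _ hcard i)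
    exact ⟨s, hS.mem_toFinset.1 hs, hk⟩
  choose p hpS hp using he
  refine ⟨p, Set.Subset.antisymm (Set.range_subset_iff.2 hpS) fun s hs => ?_, fun i j hij => ?_⟩
  · have : k s ∈ Set.range e := by
      rw [Finset.range_orderEmbOfFin]
      exact Finset.mem_coe.2 (Finset.mem_image_of_mem k (hS.mem_toFinset.2 hs))
    obtain ⟨i, hi⟩ := this
    exact ⟨i, hk (hpS i) hs ((hp i).trans hi)⟩
  · simp only [Function.comp_apply, hp]
    exact e.strictMono hij

/-- The points of a finite set in general position can be ordered such that two suitable points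
far away in opposite directions form a suspension with them. -/
theorem exists_isSuspension {n : ℕ} {S : Set Plane} (hS : S.Finite) (hn : S.ncard = n)
    (hgen : InGeneralPosition S) :
    ∃ (u v : Plane) (p : Fin n → Plane), IsSuspension u v p ∧ Set.range p = S := by
  obtain ⟨t, ht⟩ := exists_slope_injOn hS
  obtain ⟨p, rfl, hp⟩ := exists_strictMono_enumeration hS hn ht
  have hlt : ∀ i j, i < j → p i 0 * t - p i 1 < p j 0 * t - p j 1 := fun i j hij => hp hij
  obtain ⟨L, hL⟩ := (Set.finite_range fun i => p i 0 * t - p i 1).bddBelow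
  have hL : ∀ i, L ≤ p i 0 * t - p i 1 := fun i => hL ⟨i, rfl⟩
  -- The midpoint of the future `u` and `v`. There `q 0 * t - q 1` equals `L - 1`, which is below
  -- its values on `S`.
  let c : Plane := !₂[0, 1 - L]
  obtain ⟨B, hB⟩ := (Set.finite_range fun q : Fin n × Fin n => |signedArea (p q.1) (p q.2) c| /
    ((p q.2 0 * t - p q.2 1) - (p q.1 0 * t - p q.1 1))).bddAbove
  -- Moving from `c` by `±M` along `(1, t)` changes `signedArea (p i) (p j)` by `±M` times the key
  -- difference, so a large `M` decides the sign.
  have hM : ∃ M : ℝ, 0 < M ∧ ∀ i j, i < j → |signedArea (p i) (p j) c| <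
      M * ((p j 0 * t - p j 1) - (p i 0 * t - p i 1)) := by
    refine ⟨max B 0 + 1, by positivity, fun i j hij => ?_⟩
    rw [← div_lt_iff₀ (sub_pos.2 (hlt i j hij))]
    have := hB ⟨(i, j), rfl⟩
    exact (this.trans (le_max_left B 0)).trans_lt (lt_add_one _)
  obtain ⟨M, hM₀, hM⟩ := hM
  refine ⟨!₂[M, 1 - L + M * t], !₂[-M, 1 - L - M * t], p, ⟨?_, ?_, ?_, ?_, ?_⟩, rfl⟩
  · intro e
    have := congrArg (fun q : Plane => q 0) e
    simp at this
    linarith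
  · intro i
    have : 0 < 2 * M * (p i 0 * t - p i 1 - (L - 1)) := by
      have := hL i
      exact mul_pos (by linarith) (by linarith)
    simp [signedArea]
    linarith
  · intro i j hij
    have := (abs_lt.1 (hM i j hij)).1
    simp [signedArea, c] at this ⊢
    linarith
  · intro i j hij
    have := (abs_lt.1 (hM i j hij)).2
    simp [signedArea, c] at this ⊢
    linarith
  · intro i j k hij hjk hik h0
    have hinj : Function.Injective p := fun i j e => hp.injective (by simp [e])
    exact hgen _ ⟨i, rfl⟩ _ ⟨j, rfl⟩ _ ⟨k, rfl⟩ (hinj.ne hij) (hinj.ne hjk) (hinj.ne hik)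
      (collinear_of_signedArea_eq_zero h0)

theorem corollary12 (n : ℕ) (S T : Set Plane)
    (hSfin : S.Finite) (hTfin : T.Finite)
    (hScard : S.ncard = n) (hTcard : T.ncard = n)
    (hSgen : InGeneralPosition S) (hTgen : InGeneralPosition T) :
    ∃ A B : Set Plane,
      A.Finite ∧ B.Finite ∧ Disjoint S A ∧ Disjoint T B ∧
      (A.ncard : ℝ) ≤ (n : ℝ) / 6 + 3 ∧ (B.ncard : ℝ) ≤ (n : ℝ) / 6 + 3 ∧
      InGeneralPosition (S ∪ A) ∧ InGeneralPosition (T ∪ B) ∧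
      ∃ (E F : Set (Sym2 Plane)) (f : Plane → Plane),
        IsTriangulation (S ∪ A) E ∧ IsTriangulation (T ∪ B) F ∧
        CompatibleVia (S ∪ A) E (T ∪ B) F f ∧
        Set.BijOn f S T ∧ Set.BijOn f A B := by
  obtain ⟨u, v, p, h, rfl⟩ := exists_isSuspension hSfin hScard hSgen
  obtain ⟨u', v', p', h', rfl⟩ := exists_isSuspension hTfin hTcard hTgen
  obtain ⟨f, hf, hfS, hfA⟩ := exists_compatibleVia h h'
  have hcard : ∀ a b : Plane, ((({a, b} : Set Plane).ncard : ℕ) : ℝ) ≤ (n : ℝ) / 6 + 3 := by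
    intro a b
    have h₁ : ((({a, b} : Set Plane).ncard : ℕ) : ℝ) ≤ 2 := by
      exact_mod_cast (Set.ncard_insert_le a {b}).trans (by rw [Set.ncard_singleton])
    have h₂ : (0 : ℝ) ≤ (n : ℝ) / 6 := by positivity
    linarith
  refine ⟨{u, v}, {u', v'}, Set.toFinite _, Set.toFinite _, h.disjoint, h'.disjoint,
    hcard u v, hcard u' v', ?_⟩
  rw [← IsSuspension.range_suspensionPoint, ← IsSuspension.range_suspensionPoint]
  exact ⟨h.inGeneralPosition, h'.inGeneralPosition, suspensionEdges u v p,
    suspensionEdges u' v' p', f, h.isTriangulation, h'.isTriangulation, hf, hfS, hfA⟩
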